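/- Let $\varepsilon\in(0,1)$. There is a constant $c=c(\varepsilon)>0$ such that for every $\delta>0$ there is $n_0=n_0(\varepsilon,\delta)$ such that the following holds for all integers $n\ge n_0$ and all real $p$ with $n^{\varepsilon-1}\le p\le 1-\delta$. Let $G\sim G(n,p)$ be the random graph on $n$ nodes in which each pair of nodes is adjacent with probability $p$, independently of all other pairs, and let $\mathrm{ecc}(u)$ denote the eccentricity of a node $u$, that is, the maximum distance in $G$ from $u$ to another node (infinite if $G$ is disconnected). Then, with probability at least $1-\exp(-n^{c})$, for every node $u$ of $G$ there exist a triangle $\{x,y,z\}$ in $G$ and an integer $d\in\{\mathrm{ecc}(u)-2,\ \mathrm{ecc}(u)-3\}$ such that (i) the distance between $x$ and $u$ is equal to $d$, and (ii) $x$ is the unique neighbor of $y$ at distance $d$ from $u$. -/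

import Mathlib

/-- The property of a node `u` of a graph `G`: there are a triangle `{x, y, z}` and a number `d`
with `d = ecc(u) - 2` or `d = ecc(u) - 3` such that `x` is at distance `d` from `u`, and `x` is the
unique neighbor of `y` at distance `d` from `u`.

Distances and eccentricities take values in `ℕ∞` and are `⊤` when there is no path, so the property
fails if `G` is disconnected. The two values of `d` are written without truncated subtraction. -/
def SimpleGraph.HasEccentricityTriangle {V : Type*} (G : SimpleGraph V) (u : V) : Prop :=
  ∃ (x y z : V) (d : ℕ),
    (G.Adj x y ∧ G.Adj y z ∧ G.Adj x z) ∧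
    ((d : ℕ∞) + 2 = G.eccent u ∨ (d : ℕ∞) + 3 = G.eccent u) ∧
    G.edist x u = d ∧
    {w : V | G.Adj y w ∧ G.edist w u = d} = {x}

/-! Write D = np and S_i for the sphere of radius i about u. Spheres grow by a factor of order D
while p|S_i| is small. Let k be the first radius with p|S_k| ≥ m₀, where m₀ = n^(ε/2). A vertex at
distance more than k + 1 would have no neighbor in S_k, which has probability at most exp(-m₀); so
ecc(u) is k or k + 1 (`edist_le_of_spherePairs`).

Take d = k - 2. Then p|S_d| < 1/10 by `ExpandsBy.jump`, so a constant proportion of the edges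
leaving the ball of radius d end in vertices with a single neighbor in S_d. Hence order |S_d|D²
pairs {y, z} share such a private neighbor x (`ExpandsBy.le_card_privatePairs`). Degrees are at most
1.1 D, so |S_d|D² ≥ |S_k|/1.21, and p times the number of pairs is at least m₀/25. Some pair is
therefore an edge, and it closes a triangle with x. If k = 1, then d = 0 works, because no vertex is
adjacent to all others and ecc(u) = 2.

Both families of candidate edges depend on the graph, but switching edges inside a family does not
change it, so its edges are still undecided (`binomialRandom_real_deferred_le`). Expansion follows
from a Chernoff bound and a union bound over all vertex sets. -/

namespace SimpleGraph

open MeasureTheory ProbabilityTheory Finset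
open scoped Classical

/-! ### Probabilistic tools: a Chernoff bound and deferred decisions. -/

section

variable {V : Type*} [Fintype V]

instance discreteMeasurableSpace_of_finite : DiscreteMeasurableSpace (SimpleGraph V) := by
  have : MeasurableSingletonClass (SimpleGraph V) :=
    ⟨fun G ↦ by
      have : ({G} : Set (SimpleGraph V)) = edgeSet ⁻¹' {G.edgeSet} := by
        ext H; simp
      rw [this]
      exact measurable_edgeSet (MeasurableSet.of_discrete)⟩
  infer_instance

/-- Chernoff's bound for the number of events that occur, when any `k` of the events
occur simultaneously with probability at most `r ^ k`. -/
theorem _root_.MeasureTheory.measureReal_card_filter_ge_le {Ω ι : Type*} [MeasurableSpace Ω]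
    [DiscreteMeasurableSpace Ω] [Finite Ω] (μ : Measure Ω) [IsProbabilityMeasure μ] (W : Finset ι)
    (E : ι → Set Ω) (r l t : ℝ) (hl : 0 ≤ l)
    (hE : ∀ T ⊆ W, μ.real {ω | ∀ i ∈ T, ω ∈ E i} ≤ r ^ #T) :
    μ.real {ω | t ≤ #{i ∈ W | ω ∈ E i}} ≤
      Real.exp (-(l * t)) * (1 + (Real.exp l - 1) * r) ^ #W := by
  have hl1 : 0 ≤ Real.exp l - 1 := by linarith [Real.one_le_exp hl]
  -- Expanding the product of 1 + (e^l - 1)·1_{E i} leaves only joint occurrences, so upper bounds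
  -- on these replace independence.
  have hexp : ∀ ω, Real.exp (l * #{i ∈ W | ω ∈ E i}) =
      ∑ T ∈ W.powerset, (Real.exp l - 1) ^ #T *
        ({ω | ∀ i ∈ T, ω ∈ E i} : Set Ω).indicator 1 ω := by
    intro ω
    have h1 : Real.exp (l * #{i ∈ W | ω ∈ E i}) =
        ∏ i ∈ W, (1 + if ω ∈ E i then (Real.exp l - 1) else 0) := by
      rw [mul_comm, Real.exp_nat_mul, ← Finset.prod_const, Finset.prod_filter]
      exact Finset.prod_congr rfl fun i _ ↦ by split_ifs <;> ring
    rw [h1, Finset.prod_one_add]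
    refine Finset.sum_congr rfl fun T _ ↦ ?_
    by_cases h : ∀ i ∈ T, ω ∈ E i
    · rw [Set.indicator_of_mem (by exact h), ← Finset.prod_const, Pi.one_apply, mul_one]
      exact Finset.prod_congr rfl fun i hi ↦ if_pos (h i hi)
    · rw [Set.indicator_of_notMem (by exact h), mul_zero]
      push Not at h
      obtain ⟨i, hi, h⟩ := h
      exact Finset.prod_eq_zero hi (if_neg h)
  have hint : ∀ f : Ω → ℝ, Integrable f μ := fun f ↦ .of_finite
  have hmean : ∫ ω, Real.exp (l * #{i ∈ W | ω ∈ E i}) ∂μ ≤ (1 + (Real.exp l - 1) * r) ^ #W := by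
    simp_rw [hexp]
    rw [integral_finsetSum _ fun _ _ ↦ hint _]
    simp_rw [integral_const_mul, integral_indicator_one (MeasurableSet.of_discrete)]
    calc _ ≤ ∑ T ∈ W.powerset, ((Real.exp l - 1) * r) ^ #T * 1 ^ (#W - #T) := by
            refine Finset.sum_le_sum fun T hT ↦ ?_
            rw [mul_pow, one_pow, mul_one]
            exact mul_le_mul_of_nonneg_left (hE T (Finset.mem_powerset.1 hT)) (pow_nonneg hl1 _)
      _ = _ := by rw [Finset.sum_pow_mul_eq_add_pow, add_comm]
  have hmarkov := mul_meas_ge_le_integral_of_nonneg (μ := μ)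
    (f := fun ω ↦ Real.exp (l * #{i ∈ W | ω ∈ E i})) (.of_forall fun ω ↦ (Real.exp_pos _).le)
    (hint _) (Real.exp (l * t))
  have hsub : μ.real {ω | t ≤ #{i ∈ W | ω ∈ E i}} ≤
      μ.real {ω | Real.exp (l * t) ≤ Real.exp (l * #{i ∈ W | ω ∈ E i})} :=
    measureReal_mono fun ω hω ↦ Real.exp_le_exp.2 (mul_le_mul_of_nonneg_left hω hl)
  rw [Real.exp_neg, inv_mul_eq_div, le_div_iff₀' (Real.exp_pos _)]
  exact (mul_le_mul_of_nonneg_left hsub (Real.exp_pos _).le).trans (hmarkov.trans hmean)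

open unitInterval in
-- Only an inequality, since `T` may contain diagonal pairs, which are never edges.
theorem binomialRandom_real_forall_mem_edgeSet_le (p : I) (T : Finset (Sym2 V)) :
    (binomialRandom V p).real {G | ∀ e ∈ T, e ∈ G.edgeSet} ≤ (p : ℝ) ^ #T := by
  have h : binomialRandom V p {G | ∀ e ∈ T, e ∈ G.edgeSet} ≤ (toNNReal p : ENNReal) ^ #T := by
    rw [binomialRandom_eq_map, Measure.map_apply measurable_fromEdgeSet .of_discrete,
      setBernoulli_apply']
    calc _ ≤ Measure.infinitePi (fun e : Sym2 V ↦ toNNReal p • Measure.dirac (e ∈ Sym2.diagSetᶜ) +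
            toNNReal (σ p) • Measure.dirac False) (Set.pi T fun _ ↦ {True}) := by
          refine measure_mono fun f hf e he ↦ ?_
          have := hf e he
          simp at this
          simp [this.1]
      _ = ∏ e ∈ T, _ := Measure.infinitePi_pi _ (fun _ _ ↦ .of_discrete)
      _ ≤ _ := by
          rw [← Finset.prod_const]
          refine Finset.prod_le_prod' fun e _ ↦ ?_
          simp only [Measure.coe_add, Pi.add_apply, Measure.smul_apply]
          have h2 : (Measure.dirac False : Measure Prop) {True} = 0 := by simp
          rw [h2, smul_zero, add_zero]
          calc _ ≤ (toNNReal p) • (1 : ENNReal) := by gcongr; exact prob_le_one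
            _ = _ := by rw [ENNReal.smul_def, smul_eq_mul, mul_one]
  rw [measureReal_def]
  refine (ENNReal.toReal_mono (by simp) h).trans ?_
  simp

/-- **Deferred decisions.** If the set `S G` of pairs does not change when edges in `S G` are
switched, then the pairs in `S G` are still independent of each other given `S G`. -/
theorem binomialRandom_real_deferred_le (p : unitInterval) (S : SimpleGraph V → Finset (Sym2 V))
    (hdiag : ∀ G, ∀ e ∈ S G, ¬ e.IsDiag)
    (hS : ∀ G H, (∀ e ∉ S G, e ∈ G.edgeSet ↔ e ∈ H.edgeSet) → S H = S G) (m : ℕ) :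
    (binomialRandom V p).real {G | m ≤ #(S G) ∧ ∀ e ∈ S G, e ∉ G.edgeSet} ≤ (1 - p : ℝ) ^ m := by
  set μ := binomialRandom V p
  have hp0 : 0 ≤ (p : ℝ) := p.2.1
  have hp1 : 0 ≤ 1 - (p : ℝ) := by linarith [p.2.2]
  set N := (Nat.card V).choose 2
  set E : SimpleGraph V → Finset (Sym2 V) := fun G ↦ {e | e ∈ G.edgeSet}
  have mem_E : ∀ {G e}, e ∈ E G ↔ e ∈ G.edgeSet := by simp [E]
  have hE : ∀ G, E G = G.edgeFinset := fun G ↦ by ext; simp [E]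
  have hw : ∀ G : SimpleGraph V, μ.real {G} =
      (p : ℝ) ^ #(E G) * (1 - p : ℝ) ^ (N - #(E G)) := by
    intro G
    rw [measureReal_def, binomialRandom_singleton]
    simp [N, hE, ← coe_edgeFinset]
  set B : Finset (SimpleGraph V) := {G | m ≤ #(S G) ∧ ∀ e ∈ S G, e ∉ G.edgeSet}
  have hedge : ∀ G ∈ B, ∀ T ∈ (S G).powerset,
      E (G ⊔ fromEdgeSet (T : Set (Sym2 V))) = E G ∪ T := by
    intro G hG T hT
    ext e
    simp only [mem_E, edgeSet_sup, edgeSet_fromEdgeSet, Set.mem_union, Set.mem_sdiff,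
      Finset.mem_union]
    have := fun h ↦ hdiag G e (mem_powerset.1 hT h)
    simp only [Finset.mem_coe]
    tauto
  have hsum : ∀ G ∈ B, μ.real {G} ≤ (1 - p : ℝ) ^ m *
      ∑ T ∈ (S G).powerset, μ.real {G ⊔ fromEdgeSet (T : Set (Sym2 V))} := by
    intro G hG
    have hG' := (Finset.mem_filter.1 hG).2
    have hdisj : Disjoint (E G) (S G) :=
      Finset.disjoint_right.2 fun e he h ↦ hG'.2 e he (mem_E.1 h)
    have hle : #(E G) + #(S G) ≤ N := by
      rw [← Finset.card_union_of_disjoint hdisj, ← hedge G hG _ (mem_powerset_self _)]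
      simpa [N, hE] using card_edgeFinset_le_card_choose_two (G := G ⊔ fromEdgeSet (S G : Set (Sym2 V)))
    -- Adding all possible sets of edges in `S G` removes the factor (1 - p)^#(S G) from the weight
    -- of `G`.
    have : ∑ T ∈ (S G).powerset, μ.real {G ⊔ fromEdgeSet (T : Set (Sym2 V))} =
        (p : ℝ) ^ #(E G) * (1 - p : ℝ) ^ (N - #(E G) - #(S G)) := by
      calc _ = ∑ T ∈ (S G).powerset, (p : ℝ) ^ #(E G) *
            (1 - p : ℝ) ^ (N - #(E G) - #(S G)) * ((p : ℝ) ^ #T *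
              (1 - p : ℝ) ^ (#(S G) - #T)) := by
            refine Finset.sum_congr rfl fun T hT ↦ ?_
            have hTs := mem_powerset.1 hT
            have := Finset.card_le_card hTs
            rw [hw, hedge G hG T hT, Finset.card_union_of_disjoint (hdisj.mono_right hTs), pow_add,
              show N - (#(E G) + #T) = (N - #(E G) - #(S G)) + (#(S G) - #T) by omega,
              pow_add]
            ring
        _ = _ := by rw [← Finset.mul_sum, Finset.sum_pow_mul_eq_add_pow]; simp
    rw [this, hw, show N - #(E G) = (N - #(E G) - #(S G)) + #(S G) by omega, pow_add,
      Nat.add_sub_cancel]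
    have h1 : (1 - p : ℝ) ^ #(S G) ≤ (1 - p : ℝ) ^ m :=
      pow_le_pow_of_le_one hp1 (by linarith) hG'.1
    calc _ = (1 - p : ℝ) ^ #(S G) * ((p : ℝ) ^ #(E G) *
          (1 - p : ℝ) ^ (N - #(E G) - #(S G))) := by ring
      _ ≤ _ := by gcongr
  -- The union H of `G` and `T` has `S H = S G`, and `G` has no edge there; so `T` is the part of H
  -- inside `S H` and `G` the part outside. Thus the weights of all these H sum to at most 1.
  have hinj : Set.InjOn (fun x : (_ : SimpleGraph V) × Finset (Sym2 V) ↦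
      x.1 ⊔ fromEdgeSet (x.2 : Set (Sym2 V))) (B.sigma fun G ↦ (S G).powerset) := by
    have key : ∀ G ∈ B, ∀ T ∈ (S G).powerset,
        S (G ⊔ fromEdgeSet (T : Set (Sym2 V))) = S G := by
      intro G hG T hT
      refine hS G _ fun e he ↦ ?_
      rw [← mem_E, ← mem_E, hedge G hG T hT, Finset.mem_union]
      have := fun h ↦ he (mem_powerset.1 hT h)
      tauto
    rintro ⟨G, T⟩ h ⟨G', T'⟩ h' heq
    simp only [Finset.coe_sigma, Set.mem_sigma_iff, Finset.mem_coe] at h h' heq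
    have hSS : S G = S G' := by rw [← key G h.1 T h.2, heq, key G' h'.1 T' h'.2]
    have hE : E G ∪ T = E G' ∪ T' := by
      rw [← hedge G h.1 T h.2, ← hedge G' h'.1 T' h'.2, heq]
    have hG := (Finset.mem_filter.1 h.1).2.2
    have hG' := (Finset.mem_filter.1 h'.1).2.2
    have hT := mem_powerset.1 h.2
    have hT' := mem_powerset.1 h'.2
    have hE' : ∀ e, (e ∈ G.edgeSet ∨ e ∈ T) ↔ (e ∈ G'.edgeSet ∨ e ∈ T') := fun e ↦ by
      simpa [mem_E] using Finset.ext_iff.1 hE e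
    have h1 : G = G' := by
      rw [← edgeSet_inj]
      ext e
      by_cases he : e ∈ S G
      · have := hG e he; have := hG' e (hSS ▸ he); tauto
      · have := hE' e
        have := fun h ↦ he (hT h)
        have := fun h ↦ he (hSS ▸ hT' h)
        tauto
    have h2 : T = T' := by
      ext e
      by_cases he : e ∈ S G
      · have := hG e he; have := hG' e (hSS ▸ he); have := hE' e; tauto
      · have := fun h ↦ he (hT h)
        have := fun h ↦ he (hSS ▸ hT' h)
        tauto
    rw [h1, h2]
  calc μ.real {G | m ≤ #(S G) ∧ ∀ e ∈ S G, e ∉ G.edgeSet} = ∑ G ∈ B, μ.real {G} := by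
        rw [sum_measureReal_singleton]; simp [B]
    _ ≤ ∑ G ∈ B, (1 - p : ℝ) ^ m *
          ∑ T ∈ (S G).powerset, μ.real {G ⊔ fromEdgeSet (T : Set (Sym2 V))} :=
        Finset.sum_le_sum hsum
    _ = (1 - p : ℝ) ^ m * ∑ x ∈ B.sigma fun G ↦ (S G).powerset,
          μ.real {x.1 ⊔ fromEdgeSet (x.2 : Set (Sym2 V))} := by
        rw [← Finset.mul_sum, Finset.sum_sigma]
    _ ≤ (1 - p : ℝ) ^ m * 1 := by
        gcongr
        rw [← Finset.sum_image (f := fun H ↦ μ.real {H}) hinj, sum_measureReal_singleton]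
        exact measureReal_le_one
    _ = _ := mul_one _

end

/-! ### Balls, spheres and the pairs that are explored last. -/

section

variable {V : Type*} {G H : SimpleGraph V} {u v w x y : V} {d i k : ℕ}

theorem edist_le_of_adj {n : ℕ∞} (h : G.Adj x w) (hx : G.edist x u ≤ n) :
    G.edist w u ≤ n + 1 := by
  have := G.edist_triangle (u := w) (v := x) (w := u)
  rw [edist_eq_one_iff_adj.2 h.symm] at this
  rw [add_comm]
  exact this.trans (by gcongr)

theorem exists_adj_of_edist_eq_succ (h : G.edist w u = (i + 1 : ℕ)) :
    ∃ x, G.Adj x w ∧ G.edist x u = i := by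
  obtain ⟨q, hq⟩ := exists_walk_of_edist_eq_coe h
  cases q with
  | nil => simp at hq
  | @cons _ x _ hadj q =>
    refine ⟨x, hadj.symm, le_antisymm ?_ ?_⟩
    · have := q.edist_le
      simp only [Walk.length_cons, Nat.add_right_cancel_iff] at hq
      rwa [hq] at this
    · by_contra! hlt
      have hle : G.edist x u + 1 ≤ i := Order.add_one_le_of_lt hlt
      have := (edist_le_of_adj hadj.symm le_rfl).trans hle
      rw [h] at this
      norm_cast at this
      omega

variable [Fintype V] (G)

/-- The set of vertices at distance at most `i` from `u`. -/
noncomputable def closedBallFinset (u : V) (i : ℕ) : Finset V := {w | G.edist w u ≤ i}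

/-- The set of vertices at distance exactly `i` from `u`. -/
noncomputable def sphereFinset (u : V) (i : ℕ) : Finset V := {w | G.edist w u = i}

/-- The set of vertices that are adjacent to a vertex of `A`. -/
noncomputable def neighborFinsetOf (A : Finset V) : Finset V := {w | ∃ x ∈ A, G.Adj x w}

/-- The vertices outside the ball of radius `d` about `u` whose only neighbor at distance `d` from
`u` is `x`. -/
noncomputable def privateNeighborFinset (u : V) (d : ℕ) (x : V) : Finset V :=
  {y | y ∉ G.closedBallFinset u d ∧ ∀ w, (w ∈ G.sphereFinset u d ∧ G.Adj w y) ↔ w = x}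

/-- The pairs of vertices that are private neighbors of the same vertex at distance `d` from
`u`. -/
noncomputable def privatePairs (u : V) (d : ℕ) : Finset (Sym2 V) :=
  (G.sphereFinset u d).biUnion fun x ↦ (G.privateNeighborFinset u d x).offDiag.image (Sym2.mk).uncurry

/-- The pairs consisting of `v` and of a vertex whose distance from `u` in the graph without `v`
is `k`. -/
noncomputable def spherePairs (u v : V) (k : ℕ) : Finset (Sym2 V) :=
  (((G.deleteIncidenceSet v).sphereFinset u k).erase v).image fun x ↦ s(v, x)

variable {G}

@[simp] theorem mem_closedBallFinset : w ∈ G.closedBallFinset u i ↔ G.edist w u ≤ i := by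
  simp [closedBallFinset]

@[simp] theorem mem_sphereFinset : w ∈ G.sphereFinset u i ↔ G.edist w u = i := by
  simp [sphereFinset]

@[simp] theorem mem_neighborFinsetOf {A : Finset V} :
    w ∈ G.neighborFinsetOf A ↔ ∃ x ∈ A, G.Adj x w := by
  simp [neighborFinsetOf]

theorem closedBallFinset_zero : G.closedBallFinset u 0 = {u} := by
  ext; simp

theorem sphereFinset_zero : G.sphereFinset u 0 = {u} := by
  ext; simp

theorem closedBallFinset_subset_succ : G.closedBallFinset u i ⊆ G.closedBallFinset u (i + 1) := by
  intro w
  simp only [mem_closedBallFinset]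
  exact fun h ↦ h.trans (by exact_mod_cast i.le_succ)

theorem sphereFinset_subset_closedBallFinset : G.sphereFinset u i ⊆ G.closedBallFinset u i := by
  intro w
  simpa using fun h ↦ h.le

theorem disjoint_closedBallFinset_sphereFinset_succ :
    Disjoint (G.closedBallFinset u i) (G.sphereFinset u (i + 1)) := by
  refine Finset.disjoint_left.2 fun w h h' ↦ ?_
  simp only [mem_closedBallFinset, mem_sphereFinset] at h h'
  rw [h'] at h
  norm_cast at h
  omega

theorem closedBallFinset_succ :
    G.closedBallFinset u (i + 1) = G.closedBallFinset u i ∪ G.sphereFinset u (i + 1) := by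
  ext w
  simp only [mem_closedBallFinset, mem_sphereFinset, Finset.mem_union]
  constructor
  · intro h
    rcases h.lt_or_eq with h | h
    · left
      exact Order.le_of_lt_add_one (by exact_mod_cast h)
    · exact .inr h
  · rintro (h | h)
    · exact h.trans (by exact_mod_cast i.le_succ)
    · exact h.le

theorem mem_closedBallFinset_succ_iff : w ∈ G.closedBallFinset u (i + 1) ↔
    w ∈ G.closedBallFinset u i ∨ ∃ x ∈ G.closedBallFinset u i, G.Adj x w := by
  constructor
  · rw [closedBallFinset_succ, Finset.mem_union]
    refine Or.imp_right fun h ↦ ?_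
    obtain ⟨x, hx, hd⟩ := exists_adj_of_edist_eq_succ (mem_sphereFinset.1 h)
    exact ⟨x, by simp [hd], hx⟩
  · rintro (h | ⟨x, hx, hadj⟩)
    · exact closedBallFinset_subset_succ h
    · simpa using edist_le_of_adj hadj (mem_closedBallFinset.1 hx)

theorem sphereFinset_succ_eq_sdiff :
    G.sphereFinset u (i + 1) = G.closedBallFinset u (i + 1) \ G.closedBallFinset u i := by
  rw [closedBallFinset_succ, Finset.union_sdiff_cancel_left
    disjoint_closedBallFinset_sphereFinset_succ]

theorem neighborFinsetOf_sphereFinset_sdiff_subset :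
    G.neighborFinsetOf (G.sphereFinset u i) \ G.closedBallFinset u i ⊆
      G.sphereFinset u (i + 1) := by
  intro w
  simp only [Finset.mem_sdiff, mem_neighborFinsetOf, sphereFinset_succ_eq_sdiff (i := i)]
  rintro ⟨⟨x, hx, hadj⟩, hw⟩
  exact ⟨mem_closedBallFinset_succ_iff.2
    (.inr ⟨x, sphereFinset_subset_closedBallFinset hx, hadj⟩), hw⟩

theorem sphereFinset_succ_subset_neighborFinsetOf :
    G.sphereFinset u (i + 1) ⊆ G.neighborFinsetOf (G.sphereFinset u i) := by
  intro w hw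
  obtain ⟨x, hx, hd⟩ := exists_adj_of_edist_eq_succ (mem_sphereFinset.1 hw)
  exact mem_neighborFinsetOf.2 ⟨x, by simp [hd], hx⟩

/-- Each ball is determined by the edges that meet the previous one, which is why radius `d + 1` is
still covered. -/
theorem closedBallFinset_congr (h : ∀ a ∈ G.closedBallFinset u d, ∀ b, G.Adj a b ↔ H.Adj a b) :
    ∀ i ≤ d + 1, H.closedBallFinset u i = G.closedBallFinset u i := by
  have hmono : ∀ i ≤ d, G.closedBallFinset u i ⊆ G.closedBallFinset u d := fun i hi w ↦ by
    simp only [mem_closedBallFinset]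
    exact fun h ↦ h.trans (by exact_mod_cast hi)
  intro i
  induction i with
  | zero => simp [closedBallFinset_zero]
  | succ i ih =>
    intro hi
    have ih := ih (by omega)
    ext w
    rw [mem_closedBallFinset_succ_iff, mem_closedBallFinset_succ_iff, ih]
    refine or_congr_right (exists_congr fun x ↦ and_congr_right fun hx ↦ ?_)
    exact (h x (hmono i (by omega) hx) w).symm

theorem sphereFinset_congr (h : ∀ a ∈ G.closedBallFinset u d, ∀ b, G.Adj a b ↔ H.Adj a b)
    (hi : i ≤ d + 1) : H.sphereFinset u i = G.sphereFinset u i := by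
  cases i with
  | zero => simp [sphereFinset_zero]
  | succ i =>
    rw [sphereFinset_succ_eq_sdiff, sphereFinset_succ_eq_sdiff, closedBallFinset_congr h _ hi,
      closedBallFinset_congr h i (by omega)]

theorem mk_mem_privatePairs : s(y, w) ∈ G.privatePairs u d ↔
    y ≠ w ∧ ∃ x ∈ G.sphereFinset u d,
      y ∈ G.privateNeighborFinset u d x ∧ w ∈ G.privateNeighborFinset u d x := by
  simp only [privatePairs, Finset.mem_biUnion, Finset.mem_image, Finset.mem_offDiag, Prod.exists,
    Function.uncurry_apply_pair, Sym2.eq_iff]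
  constructor
  · rintro ⟨x, hx, a, b, ⟨ha, hb, hab⟩, ⟨rfl, rfl⟩ | ⟨rfl, rfl⟩⟩
    · exact ⟨hab, x, hx, ha, hb⟩
    · exact ⟨hab.symm, x, hx, hb, ha⟩
  · rintro ⟨hab, x, hx, ha, hb⟩
    exact ⟨x, hx, y, w, ⟨ha, hb, hab⟩, .inl ⟨rfl, rfl⟩⟩

theorem not_isDiag_of_mem_privatePairs : ∀ e ∈ G.privatePairs u d, ¬ e.IsDiag := by
  intro e
  induction e with | _ y w
  simpa using fun h ↦ (mk_mem_privatePairs.1 h).1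

/-- Private pairs avoid the ball of radius `d`, while the ball, the sphere and the private neighbors
are read off from edges that meet the ball. -/
theorem privatePairs_congr
    (h : ∀ e ∉ G.privatePairs u d, e ∈ G.edgeSet ↔ e ∈ H.edgeSet) :
    H.privatePairs u d = G.privatePairs u d := by
  have hadj : ∀ a ∈ G.closedBallFinset u d, ∀ b, G.Adj a b ↔ H.Adj a b := by
    intro a ha b
    refine h s(a, b) fun hab ↦ ?_
    obtain ⟨-, x, -, hy, -⟩ := mk_mem_privatePairs.1 hab
    exact (Finset.mem_filter.1 hy).2.1 ha
  have hb := closedBallFinset_congr hadj d (by omega)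
  have hs := sphereFinset_congr hadj (i := d) (by omega)
  have hp : ∀ x, H.privateNeighborFinset u d x = G.privateNeighborFinset u d x := by
    intro x
    simp only [privateNeighborFinset, hb, hs]
    refine Finset.filter_congr fun y _ ↦ and_congr_right fun _ ↦ forall_congr' fun w ↦
      iff_congr (and_congr_right fun hw ↦ ?_) Iff.rfl
    exact (hadj w (sphereFinset_subset_closedBallFinset hw) y).symm
  simp only [privatePairs, hp, hs]

theorem not_isDiag_of_mem_spherePairs : ∀ e ∈ G.spherePairs u v k, ¬ e.IsDiag := by
  simp only [spherePairs, Finset.mem_image, Finset.mem_erase]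
  rintro _ ⟨x, ⟨hx, -⟩, rfl⟩
  simpa using hx.symm

/-- All these pairs contain `v`, and distances are measured after deleting the edges at `v`. -/
theorem spherePairs_congr
    (h : ∀ e ∉ G.spherePairs u v k, e ∈ G.edgeSet ↔ e ∈ H.edgeSet) :
    H.spherePairs u v k = G.spherePairs u v k := by
  have : H.deleteIncidenceSet v = G.deleteIncidenceSet v := by
    ext a b
    simp only [deleteIncidenceSet_adj]
    refine and_congr_left fun hab ↦ ?_
    refine (h s(a, b) fun hmem ↦ ?_).symm
    simp only [spherePairs, Finset.mem_image, Finset.mem_erase, Sym2.eq_iff] at hmem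
    obtain ⟨x, -, ⟨h1, -⟩ | ⟨h1, -⟩⟩ := hmem
    · exact hab.1 h1.symm
    · exact hab.2 h1.symm
  rw [spherePairs, this, spherePairs]

/-- If every vertex `v` is adjacent to the vertices at distance `k` from `u` in `G` without `v`
once there are enough of them, then all distances from `u` are at most `k + 1`. -/
theorem edist_le_of_spherePairs {M : ℕ}
    (h : ∀ v, M ≤ #(G.spherePairs u v k) → ∃ e ∈ G.spherePairs u v k, e ∈ G.edgeSet)
    (hM : M ≤ #(G.sphereFinset u k)) (v : V) : G.edist v u ≤ k + 1 := by
  by_contra hv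
  have hv' : v ∉ G.closedBallFinset u (k + 1) := by simpa using hv
  -- A vertex beyond distance `k + 1` has no neighbor in the ball of radius `k`, so deleting its
  -- edges does not affect the sphere.
  have hadj : ∀ a ∈ G.closedBallFinset u k, ∀ b,
      G.Adj a b ↔ (G.deleteIncidenceSet v).Adj a b := by
    intro a ha b
    rw [deleteIncidenceSet_adj]
    refine ⟨fun hab ↦ ⟨hab, ?_, ?_⟩, fun h ↦ h.1⟩
    · rintro rfl
      exact hv' (closedBallFinset_subset_succ ha)
    · rintro rfl
      exact hv' (mem_closedBallFinset_succ_iff.2 (.inr ⟨a, ha, hab⟩))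
  have hs := sphereFinset_congr hadj (i := k) (by omega)
  have hvs : v ∉ G.sphereFinset u k := fun h ↦
    hv' (closedBallFinset_subset_succ (sphereFinset_subset_closedBallFinset h))
  have hcard : #(G.spherePairs u v k) = #(G.sphereFinset u k) := by
    rw [spherePairs, hs, Finset.erase_eq_of_notMem hvs]
    exact Finset.card_image_of_injective _ fun a b hab ↦ Sym2.congr_right.1 hab
  obtain ⟨e, he, heG⟩ := h v (hcard ▸ hM)
  simp only [spherePairs, Finset.mem_image, hs] at he
  obtain ⟨x, hx, rfl⟩ := he
  exact hv' (mem_closedBallFinset_succ_iff.2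
    (.inr ⟨x, sphereFinset_subset_closedBallFinset (Finset.mem_of_mem_erase hx),
      (G.mem_edgeSet.1 heG).symm⟩))

theorem hasEccentricityTriangle_of_privatePairs
    (he : ∃ e ∈ G.privatePairs u d, e ∈ G.edgeSet)
    (hd : (d : ℕ∞) + 2 = G.eccent u ∨ (d : ℕ∞) + 3 = G.eccent u) :
    G.HasEccentricityTriangle u := by
  obtain ⟨e, he, heG⟩ := he
  induction e with | _ y z
  obtain ⟨-, x, hx, hy, hz⟩ := mk_mem_privatePairs.1 he
  have hy := (Finset.mem_filter.1 hy).2.2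
  have hz := (Finset.mem_filter.1 hz).2.2
  refine ⟨x, y, z, d, ⟨((hy x).2 rfl).2, heG, ((hz x).2 rfl).2⟩, hd, mem_sphereFinset.1 hx, ?_⟩
  ext w
  rw [Set.mem_ofPred_eq, Set.mem_singleton_iff, ← hy w, mem_sphereFinset, adj_comm, and_comm]

end

/-! ### Expansion and the deterministic argument. -/

section

variable {V : Type*} [Fintype V] {G : SimpleGraph V} {u x y : V} {d i k : ℕ} {D p q m₀ : ℝ}

theorem eq_of_mem_privateNeighborFinset {x' : V} (h : y ∈ G.privateNeighborFinset u d x)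
    (h' : y ∈ G.privateNeighborFinset u d x') : x = x' :=
  ((Finset.mem_filter.1 h').2.2 x).1 (((Finset.mem_filter.1 h).2.2 x).2 rfl)

theorem two_mul_card_privatePairs :
    2 * #(G.privatePairs u d) = ∑ x ∈ G.sphereFinset u d,
      (#(G.privateNeighborFinset u d x) * #(G.privateNeighborFinset u d x) -
        #(G.privateNeighborFinset u d x)) := by
  rw [privatePairs, Finset.card_biUnion, Finset.mul_sum]
  · refine Finset.sum_congr rfl fun x _ ↦ ?_
    rw [← Finset.offDiag_card]
    exact Sym2.two_mul_card_image_offDiag _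
  · intro x _ x' _ hne
    refine Finset.disjoint_left.2 fun e he he' ↦ hne ?_
    simp only [Finset.mem_image, Finset.mem_offDiag, Prod.exists,
      Function.uncurry_apply_pair] at he he'
    obtain ⟨a, b, ⟨ha, hb, -⟩, rfl⟩ := he
    obtain ⟨a', b', ⟨ha', hb', -⟩, heq⟩ := he'
    rcases Sym2.eq_iff.1 heq with ⟨rfl, rfl⟩ | ⟨rfl, rfl⟩
    · exact eq_of_mem_privateNeighborFinset ha ha'
    · exact eq_of_mem_privateNeighborFinset ha hb'

/-- A double count of the edges between the sphere of radius `d` and the outside of the ball of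
radius `d`. -/
theorem two_mul_card_le_sum_card_privateNeighborFinset :
    2 * #(G.neighborFinsetOf (G.sphereFinset u d) \ G.closedBallFinset u d) ≤
      ∑ x ∈ G.sphereFinset u d, #{y | G.Adj x y} +
        ∑ x ∈ G.sphereFinset u d, #(G.privateNeighborFinset u d x) := by
  set A := G.sphereFinset u d
  set N := G.neighborFinsetOf A \ G.closedBallFinset u d
  have h1 : ∑ x ∈ A, #{y | G.Adj x y} ≥ ∑ y ∈ N, #{x ∈ A | G.Adj x y} := by
    calc ∑ x ∈ A, #{y | G.Adj x y} ≥ ∑ x ∈ A, #{y ∈ N | G.Adj x y} :=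
          Finset.sum_le_sum fun x _ ↦ Finset.card_le_card
            (Finset.filter_subset_filter _ (Finset.subset_univ _))
      _ = _ := Finset.sum_card_bipartiteAbove_eq_sum_card_bipartiteBelow _
  have h2 : ∑ x ∈ A, #(G.privateNeighborFinset u d x) ≥
      ∑ y ∈ N, if #{x ∈ A | G.Adj x y} = 1 then 1 else 0 := by
    rw [← Finset.card_filter]
    refine (Finset.card_le_card ?_).trans Finset.card_biUnion_le
    intro y hy
    obtain ⟨hyN, hy⟩ := Finset.mem_filter.1 hy
    obtain ⟨x, hx⟩ := Finset.card_eq_one.1 hy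
    have hx' : ∀ w, (w ∈ A ∧ G.Adj w y) ↔ w = x := fun w ↦ by
      simpa using Finset.ext_iff.1 hx w
    exact Finset.mem_biUnion.2 ⟨x, ((hx' x).2 rfl).1, by
      simp only [privateNeighborFinset, Finset.mem_filter, Finset.mem_univ, true_and]
      exact ⟨(Finset.mem_sdiff.1 hyN).2, hx'⟩⟩
  refine le_trans ?_ (add_le_add h1 h2)
  rw [← Finset.sum_add_distrib, mul_comm, ← smul_eq_mul, ← Finset.sum_const]
  -- A positive integer plus the indicator that it equals 1 is at least 2.
  refine Finset.sum_le_sum fun y hy ↦ ?_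
  obtain ⟨x, hx, hadj⟩ := mem_neighborFinsetOf.1 (Finset.mem_sdiff.1 hy).1
  have : 0 < #{x ∈ A | G.Adj x y} :=
    Finset.card_pos.2 ⟨x, Finset.mem_filter.2 ⟨hx, hadj⟩⟩
  split_ifs <;> omega

/-- Sets `A` with `q * (#A - 1) ≤ 1 / 10` expand by almost a factor of `D`, which is almost the
maximum degree. -/
structure ExpandsBy (G : SimpleGraph V) (q D : ℝ) : Prop where
  card_adj_le : ∀ x, (#{y | G.Adj x y} : ℝ) ≤ 11 / 10 * D
  le_card_sdiff : ∀ A : Finset V, A.Nonempty → q * (#A - 1) ≤ 1 / 10 →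
    4 / 5 * (#A * D) ≤ #(G.neighborFinsetOf A \ A)

namespace ExpandsBy

theorem card_sphereFinset_succ_le (h : G.ExpandsBy q D) :
    (#(G.sphereFinset u (i + 1)) : ℝ) ≤ #(G.sphereFinset u i) * (11 / 10 * D) := by
  have : #(G.sphereFinset u (i + 1)) ≤ ∑ x ∈ G.sphereFinset u i, #{y | G.Adj x y} := by
    refine (Finset.card_le_card sphereFinset_succ_subset_neighborFinsetOf).trans
      ((Finset.card_le_card fun y hy ↦ ?_).trans Finset.card_biUnion_le)
    simpa using hy
  calc (#(G.sphereFinset u (i + 1)) : ℝ) ≤ ∑ x ∈ G.sphereFinset u i, (#{y | G.Adj x y} : ℝ) := by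
        exact_mod_cast this
    _ ≤ ∑ x ∈ G.sphereFinset u i, 11 / 10 * D := Finset.sum_le_sum fun x _ ↦ h.card_adj_le x
    _ = _ := by rw [Finset.sum_const, nsmul_eq_mul]

theorem le_card_sdiff_closedBallFinset (h : G.ExpandsBy q D) {A : Finset V}
    (hA : A ⊆ G.sphereFinset u i) (hne : A.Nonempty) (hq : q * (#A - 1) ≤ 1 / 10) :
    4 / 5 * (#A * D) - #(G.closedBallFinset u i) ≤
      #(G.neighborFinsetOf (G.sphereFinset u i) \ G.closedBallFinset u i) := by
  have h1 := h.le_card_sdiff A hne hq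
  have h2 : #(G.neighborFinsetOf A \ A) ≤
      #(G.neighborFinsetOf (G.sphereFinset u i) \ G.closedBallFinset u i) +
        #(G.closedBallFinset u i) := by
    refine (Finset.card_le_card fun y hy ↦ ?_).trans (Finset.card_union_le _ _)
    obtain ⟨x, hx, hadj⟩ := mem_neighborFinsetOf.1 (Finset.mem_sdiff.1 hy).1
    simp only [Finset.mem_union, Finset.mem_sdiff, mem_neighborFinsetOf]
    by_cases hy : y ∈ G.closedBallFinset u i
    · exact .inr hy
    · exact .inl ⟨⟨x, hA hx, hadj⟩, hy⟩
  have h3 : (#(G.neighborFinsetOf A \ A) : ℝ) ≤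
      #(G.neighborFinsetOf (G.sphereFinset u i) \ G.closedBallFinset u i) +
        #(G.closedBallFinset u i) := by exact_mod_cast h2
  linarith

theorem card_le_card_sphereFinset_succ (h : G.ExpandsBy q D) {A : Finset V}
    (hA : A ⊆ G.sphereFinset u i) (hne : A.Nonempty) (hq : q * (#A - 1) ≤ 1 / 10) :
    4 / 5 * (#A * D) - #(G.closedBallFinset u i) ≤ #(G.sphereFinset u (i + 1)) :=
  (h.le_card_sdiff_closedBallFinset hA hne hq).trans
    (Nat.cast_le.2 (Finset.card_le_card neighborFinsetOf_sphereFinset_sdiff_subset))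

theorem grow (h : G.ExpandsBy q D) (hD : 100 ≤ D)
    (hB : #(G.closedBallFinset u i) ≤ 2 * #(G.sphereFinset u i))
    (hne : (G.sphereFinset u i).Nonempty) (hq : q * (#(G.sphereFinset u i) - 1) ≤ 1 / 10) :
    2 * #(G.sphereFinset u i) ≤ #(G.sphereFinset u (i + 1)) ∧
      #(G.closedBallFinset u (i + 1)) ≤ 2 * #(G.sphereFinset u (i + 1)) := by
  have h1 := h.card_le_card_sphereFinset_succ subset_rfl hne hq
  have hB' : (#(G.closedBallFinset u i) : ℝ) ≤ 2 * #(G.sphereFinset u i) := by exact_mod_cast hB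
  have h2 : (2 * #(G.sphereFinset u i) : ℝ) ≤ #(G.sphereFinset u (i + 1)) := by
    have : (0 : ℝ) ≤ #(G.sphereFinset u i) := by positivity
    nlinarith
  have h3 : 2 * #(G.sphereFinset u i) ≤ #(G.sphereFinset u (i + 1)) := by exact_mod_cast h2
  refine ⟨h3, ?_⟩
  rw [closedBallFinset_succ,
    Finset.card_union_of_disjoint disjoint_closedBallFinset_sphereFinset_succ]
  omega

/-- A subset `A` of the sphere with ⌈1/(10q)⌉ elements is as large as expansion allows. Its
neighborhood contributes at least 4/5 · D/10 = 2D/25 after scaling by `q`, and the ball takes away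
at most 2`m₀`. Consequently `q` times the sphere size stays below 1/10 until the last step before it
reaches `m₀`. -/
theorem jump (h : G.ExpandsBy q D) (hq : 0 < q) (hD : 100 ≤ D) (hDm : 3 * m₀ ≤ 2 / 25 * D)
    (hB : #(G.closedBallFinset u i) ≤ 2 * #(G.sphereFinset u i))
    (hlow : 1 / 10 ≤ q * #(G.sphereFinset u i)) (hup : q * #(G.sphereFinset u i) < m₀) :
    m₀ ≤ q * #(G.sphereFinset u (i + 1)) := by
  have hpos : 0 < 1 / 10 / q := by positivity
  have hle : ⌈1 / 10 / q⌉₊ ≤ #(G.sphereFinset u i) := by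
    rw [Nat.ceil_le, div_le_iff₀ hq]
    linarith
  obtain ⟨A, hA, hcard⟩ := Finset.exists_subset_card_eq hle
  have hne : A.Nonempty := Finset.card_pos.1 (by rw [hcard]; exact Nat.ceil_pos.2 hpos)
  have hA1 : 1 / 10 ≤ q * #A := by
    rw [hcard]
    have := (div_le_iff₀ hq).1 (Nat.le_ceil (1 / 10 / q))
    linarith
  have hA2 : q * (#A - 1) ≤ 1 / 10 := by
    rw [hcard]
    have := Nat.ceil_lt_add_one hpos.le
    have : (⌈1 / 10 / q⌉₊ : ℝ) - 1 ≤ 1 / 10 / q := by linarith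
    have := (le_div_iff₀ hq).1 this
    linarith
  have h1 := h.card_le_card_sphereFinset_succ hA hne hA2
  have hB' : (#(G.closedBallFinset u i) : ℝ) ≤ 2 * #(G.sphereFinset u i) := by exact_mod_cast hB
  have h2 := mul_le_mul_of_nonneg_left h1 hq.le
  have h3 := mul_le_mul_of_nonneg_left hB' hq.le
  have h4 := mul_le_mul_of_nonneg_right hA1 (by linarith : 0 ≤ D)
  linarith

theorem invariant (h : G.ExpandsBy q D) (hq : 0 < q) (hD : 100 ≤ D)
    (hDm : 3 * m₀ ≤ 2 / 25 * D) (hk : ∀ j < k, q * #(G.sphereFinset u j) < m₀) :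
    ∀ i < k, #(G.closedBallFinset u i) ≤ 2 * #(G.sphereFinset u i) ∧
      2 ^ i ≤ #(G.sphereFinset u i) := by
  intro i
  induction i with
  | zero => simp [closedBallFinset_zero, sphereFinset_zero]
  | succ i ih =>
    intro hi
    obtain ⟨hB, hS⟩ := ih (by omega)
    have hne : (G.sphereFinset u i).Nonempty :=
      Finset.card_pos.1 (lt_of_lt_of_le (by positivity) hS)
    have hlow : q * #(G.sphereFinset u i) < 1 / 10 := by
      by_contra! hcon
      exact (h.jump hq hD hDm hB hcon (hk i (by omega))).not_gt (hk _ hi)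
    have := h.grow hD hB hne (by linarith)
    exact ⟨this.2, by rw [pow_succ]; omega⟩

theorem le_card_privatePairs (h : G.ExpandsBy q D) (hD : 100 ≤ D)
    (hB : #(G.closedBallFinset u d) ≤ 2 * #(G.sphereFinset u d))
    (hne : (G.sphereFinset u d).Nonempty) (hq : q * (#(G.sphereFinset u d) - 1) ≤ 1 / 10) :
    1 / 20 * (#(G.sphereFinset u d) * D ^ 2) ≤ #(G.privatePairs u d) := by
  set a : ℝ := (#(G.sphereFinset u d) : ℝ) with ha
  set t : V → ℝ := fun x ↦ #(G.privateNeighborFinset u d x) with ht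
  have hB' : (#(G.closedBallFinset u d) : ℝ) ≤ 2 * a := by rw [ha]; exact_mod_cast hB
  have h1 := h.le_card_sdiff_closedBallFinset subset_rfl hne hq
  have h2 : (2 * #(G.neighborFinsetOf (G.sphereFinset u d) \ G.closedBallFinset u d) : ℝ) ≤
      ∑ x ∈ G.sphereFinset u d, (#{y | G.Adj x y} : ℝ) + ∑ x ∈ G.sphereFinset u d, t x := by
    have := two_mul_card_le_sum_card_privateNeighborFinset (G := G) (u := u) (d := d)
    simp only [ht]
    exact_mod_cast this
  have h3 : ∑ x ∈ G.sphereFinset u d, (#{y | G.Adj x y} : ℝ) ≤ a * (11 / 10 * D) := by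
    refine (Finset.sum_le_sum fun x _ ↦ h.card_adj_le x).trans_eq ?_
    rw [Finset.sum_const, nsmul_eq_mul]
  have h4 : (2 * #(G.privatePairs u d) : ℝ) = ∑ x ∈ G.sphereFinset u d, (t x * t x - t x) := by
    have := two_mul_card_privatePairs (G := G) (u := u) (d := d)
    have h5 := congrArg (Nat.cast : ℕ → ℝ) this
    push_cast [Nat.le_mul_self] at h5
    exact h5
  -- Convexity: t² is bounded below by its tangent at 3D/10, so only the sum of the `t x` is needed.
  -- The double count makes it at least 2aD/5.
  have h5 : ∑ x ∈ G.sphereFinset u d, ((3 / 5 * D - 1) * t x - (3 / 10 * D) ^ 2) ≤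
      ∑ x ∈ G.sphereFinset u d, (t x * t x - t x) :=
    Finset.sum_le_sum fun x _ ↦ by nlinarith [sq_nonneg (t x - 3 / 10 * D)]
  rw [Finset.sum_sub_distrib, ← Finset.mul_sum, Finset.sum_const, nsmul_eq_mul, ← ha] at h5
  have ha0 : 0 ≤ a := by positivity
  have haD : 100 * a ≤ a * D := by nlinarith
  have h6 : 2 / 5 * (a * D) ≤ ∑ x ∈ G.sphereFinset u d, t x := by linarith
  have h7 := mul_le_mul_of_nonneg_left h6 (by linarith : 0 ≤ 3 / 5 * D - 1)
  have h8 := mul_le_mul_of_nonneg_right haD (by linarith : 0 ≤ D)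
  nlinarith

/-- The deterministic part of the argument: expansion, together with the presence of an edge in
each of the large enough sets of pairs that are explored last, yields the triangles. -/
theorem hasEccentricityTriangle (h : G.ExpandsBy q D) (hq : 0 < q) (hq1 : q < 1) (hD : 100 ≤ D)
    (hm : 1 ≤ m₀) (hDm : 3 * m₀ ≤ 2 / 25 * D)
    (hdeg : ∀ x, ∃ y, x ≠ y ∧ ¬ G.Adj x y)
    (hreach : ∀ k ≤ Fintype.card V, ∀ v, m₀ ≤ q * #(G.spherePairs u v k) →
      ∃ e ∈ G.spherePairs u v k, e ∈ G.edgeSet)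
    (htri : ∀ d ≤ Fintype.card V, m₀ / 25 ≤ q * #(G.privatePairs u d) →
      ∃ e ∈ G.privatePairs u d, e ∈ G.edgeSet) :
    G.HasEccentricityTriangle u := by
  -- Otherwise the spheres would double forever.
  have hex : ∃ k, m₀ ≤ q * #(G.sphereFinset u k) := by
    by_contra! hcon
    have h1 := (h.invariant hq hD hDm (k := Fintype.card V + 1) (fun j _ ↦ hcon j)
      (Fintype.card V) (by omega)).2
    exact (h1.trans (Finset.card_le_univ _)).not_gt Nat.lt_two_pow_self
  obtain ⟨k, hk, hmin⟩ : ∃ k, m₀ ≤ q * #(G.sphereFinset u k) ∧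
      ∀ j < k, q * #(G.sphereFinset u j) < m₀ :=
    ⟨Nat.find hex, Nat.find_spec hex, fun j hj ↦ not_le.1 (Nat.find_min hex hj)⟩
  have hinv := h.invariant hq hD hDm hmin
  have hk0 : k ≠ 0 := by
    rintro rfl
    simp only [sphereFinset_zero, Finset.card_singleton, Nat.cast_one, mul_one] at hk
    linarith
  have hkn : k ≤ Fintype.card V := by
    have h1 := (hinv (k - 1) (by omega)).2.trans (Finset.card_le_univ _)
    have := (Nat.lt_two_pow_self (n := k - 1)).trans_le h1
    omega
  have hupper : G.eccent u ≤ k + 1 := by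
    rw [eccent_le_iff]
    intro v
    rw [edist_comm]
    refine edist_le_of_spherePairs (M := #(G.sphereFinset u k)) (fun v hv ↦ hreach k hkn v ?_)
      le_rfl v
    refine hk.trans (mul_le_mul_of_nonneg_left ?_ hq.le)
    exact_mod_cast hv
  have hlower : (k : ℕ∞) ≤ G.eccent u := by
    have : (G.sphereFinset u k).Nonempty := by
      rw [Finset.nonempty_iff_ne_empty]
      intro h0
      simp only [h0, Finset.card_empty, Nat.cast_zero, mul_zero] at hk
      linarith
    obtain ⟨w, hw⟩ := this
    rw [← mem_sphereFinset.1 hw, edist_comm]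
    exact edist_le_eccent
  have hcases : (k : ℕ∞) = G.eccent u ∨ (k : ℕ∞) + 1 = G.eccent u := by
    rcases hupper.lt_or_eq with hlt | heq
    · exact .inl (le_antisymm hlower (Order.le_of_lt_add_one hlt))
    · exact .inr heq.symm
  -- Two steps of growth by at most 11/10 · D give 121/100; with the 1/20 of `le_card_privatePairs`
  -- this yields `m₀`/24.2 ≥ `m₀`/25.
  suffices hmain : ∃ d < k, ((d : ℕ∞) + 2 = G.eccent u ∨ (d : ℕ∞) + 3 = G.eccent u) ∧
      q * (#(G.sphereFinset u d) - 1) ≤ 1 / 10 ∧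
      m₀ ≤ q * (121 / 100 * (#(G.sphereFinset u d) * D ^ 2)) by
    obtain ⟨d, hdk, hd, hd1, hd2⟩ := hmain
    obtain ⟨hB, hS⟩ := hinv d hdk
    have hne : (G.sphereFinset u d).Nonempty :=
      Finset.card_pos.1 (lt_of_lt_of_le (by positivity) hS)
    refine hasEccentricityTriangle_of_privatePairs (htri d (by omega) ?_) hd
    have h1 := mul_le_mul_of_nonneg_left (h.le_card_privatePairs hD hB hne hd1) hq.le
    have h2 : 0 ≤ q * (#(G.sphereFinset u d) * D ^ 2) := by positivity
    linarith
  obtain rfl | ⟨d, rfl⟩ : k = 1 ∨ ∃ d, k = d + 2 := by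
    rcases k with _ | _ | d
    · exact absurd rfl hk0
    · exact .inl rfl
    · exact .inr ⟨d, rfl⟩
  -- Here `q` may exceed 1/10; the `- 1` in the expansion hypothesis admits the single vertex `u`
  -- for every `q`.
  · refine ⟨0, one_pos, .inl ?_, by simp [sphereFinset_zero], ?_⟩
    · rcases hcases with h1 | h1
      · obtain ⟨y, hy, hadj⟩ := hdeg u
        exact absurd ((eccent_le_one_iff u).1 (by rw [← h1]; simp) y hy) hadj
      · rw [← h1]; norm_num
    · have h1 := mul_le_mul_of_nonneg_left (h.card_sphereFinset_succ_le (u := u) (i := 0)) hq.le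
      rw [sphereFinset_zero] at h1 ⊢
      simp only [Finset.card_singleton, Nat.cast_one, one_mul] at h1 ⊢
      refine (hk.trans h1).trans (mul_le_mul_of_nonneg_left ?_ hq.le)
      nlinarith
  · refine ⟨d, by omega, ?_, ?_, ?_⟩
    · refine hcases.imp (fun h ↦ ?_) fun h ↦ ?_
      · rw [← h]; norm_cast
      · rw [← h]; norm_cast
    · have : q * #(G.sphereFinset u d) < 1 / 10 := by
        by_contra! hcon
        exact (h.jump hq hD hDm (hinv d (by omega)).1 hcon (hmin d (by omega))).not_gt
          (hmin _ (by omega))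
      linarith
    · refine hk.trans (mul_le_mul_of_nonneg_left ?_ hq.le)
      have h1 := h.card_sphereFinset_succ_le (u := u) (i := d)
      have h2 := h.card_sphereFinset_succ_le (u := u) (i := d + 1)
      have h3 := mul_le_mul_of_nonneg_right h1 (by linarith : 0 ≤ 11 / 10 * D)
      linarith

end ExpandsBy

end

/-! ### Probability of expansion and union bounds. -/

section

variable {V : Type*} [Fintype V] {p : unitInterval} {D m₀ : ℝ}

theorem binomialRandom_real_deferred_le_exp (hp : 0 < (p : ℝ)) (S : SimpleGraph V → Finset (Sym2 V))
    (hdiag : ∀ G, ∀ e ∈ S G, ¬ e.IsDiag)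
    (hS : ∀ G H, (∀ e ∉ S G, e ∈ G.edgeSet ↔ e ∈ H.edgeSet) → S H = S G) (t : ℝ) :
    (binomialRandom V p).real {G | t ≤ p * #(S G) ∧ ∀ e ∈ S G, e ∉ G.edgeSet} ≤ Real.exp (-t) := by
  have hp1 : 0 ≤ 1 - (p : ℝ) := by linarith [p.2.2]
  calc _ ≤ (binomialRandom V p).real {G | ⌈t / p⌉₊ ≤ #(S G) ∧ ∀ e ∈ S G, e ∉ G.edgeSet} := by
        refine measureReal_mono fun G hG ↦ ⟨?_, hG.2⟩
        rw [Nat.ceil_le, div_le_iff₀ hp, mul_comm]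
        exact hG.1
    _ ≤ (1 - p : ℝ) ^ ⌈t / p⌉₊ := binomialRandom_real_deferred_le p S hdiag hS _
    _ ≤ Real.exp (-p) ^ ⌈t / p⌉₊ := by
        gcongr
        linarith [Real.add_one_le_exp (-(p : ℝ))]
    _ = Real.exp (-(⌈t / p⌉₊ * p)) := by rw [← Real.exp_nat_mul]; ring_nf
    _ ≤ _ := by
        gcongr
        exact (div_le_iff₀ hp).1 (Nat.le_ceil _)

theorem binomialRandom_real_card_adj_gt_le (x : V) (hD : D = Fintype.card V * p) :
    (binomialRandom V p).real {G | 11 / 10 * D < #{y | G.Adj x y}} ≤ Real.exp (-(D / 400)) := by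
  have h1 := measureReal_card_filter_ge_le (binomialRandom V p) Finset.univ
    (fun y ↦ {G : SimpleGraph V | G.Adj x y}) p (1 / 20) (11 / 10 * D) (by norm_num) (by
      intro T _
      have := binomialRandom_real_forall_mem_edgeSet_le p (T.image fun y ↦ s(x, y))
      rw [Finset.card_image_of_injective _ fun a b hab ↦ Sym2.congr_right.1 hab] at this
      simpa using this)
  have hp0 : 0 ≤ (p : ℝ) := p.2.1
  have hD0 : 0 ≤ D := by rw [hD]; positivity
  -- This gives e^(1/20) - 1 ≤ 21/400, against 1/20 · 11/10 = 22/400; the difference is the 1/400 in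
  -- the bound.
  have hexp := (abs_le.1 (Real.abs_exp_sub_one_sub_id_le (x := 1 / 20) (by norm_num))).2
  calc _ ≤ _ := measureReal_mono fun G hG ↦ le_of_lt (by simpa using hG)
    _ ≤ _ := h1
    _ ≤ Real.exp (-(1 / 20 * (11 / 10 * D))) *
        Real.exp ((Real.exp (1 / 20) - 1) * p) ^ #(Finset.univ : Finset V) := by
        have : 0 ≤ Real.exp (1 / 20) - 1 := by linarith [Real.one_le_exp (x := 1 / 20) (by norm_num)]
        gcongr
        linarith [Real.add_one_le_exp ((Real.exp (1 / 20) - 1) * (p : ℝ))]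
    _ ≤ _ := by
        rw [← Real.exp_nat_mul, ← Real.exp_add, Finset.card_univ, Real.exp_le_exp]
        have : (Fintype.card V : ℝ) * ((Real.exp (1 / 20) - 1) * p) =
          (Real.exp (1 / 20) - 1) * D := by rw [hD]; ring
        rw [this]
        nlinarith

theorem binomialRandom_real_forall_not_adj_le (A T : Finset V) (h : Disjoint A T) :
    (binomialRandom V p).real {G | ∀ y ∈ T, ∀ x ∈ A, ¬ G.Adj x y} ≤ ((1 - p : ℝ) ^ #A) ^ #T := by
  have hne : ∀ x ∈ A, ∀ y ∈ T, x ≠ y := fun x hx y hy he ↦ Finset.disjoint_left.1 h hx (he ▸ hy)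
  have hcard : #((A ×ˢ T).image Sym2.mk.uncurry) = #A * #T := by
    rw [← Finset.card_product]
    refine Finset.card_image_of_injOn ?_
    rintro ⟨x, y⟩ h1 ⟨x', y'⟩ h2 heq
    simp only [Finset.coe_product, Set.mem_prod, Finset.mem_coe] at h1 h2
    rcases Sym2.eq_iff.1 heq with ⟨rfl, rfl⟩ | ⟨rfl, rfl⟩
    · rfl
    · exact absurd rfl (hne _ h1.1 _ h2.2)
  -- A constant set of pairs turns deferred decisions into plain independence.
  have := binomialRandom_real_deferred_le p (fun _ ↦ (A ×ˢ T).image Sym2.mk.uncurry) (by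
    rintro _ e he
    simp only [Finset.mem_image, Finset.mem_product, Prod.exists] at he
    obtain ⟨x, y, ⟨hx, hy⟩, rfl⟩ := he
    simpa using hne x hx y hy) (fun _ _ _ ↦ rfl) (#A * #T)
  rw [← pow_mul]
  refine le_trans (measureReal_mono ?_) this
  refine fun G hG ↦ ⟨hcard.ge, fun e he ↦ ?_⟩
  simp only [Finset.mem_image, Finset.mem_product, Prod.exists] at he
  obtain ⟨x, y, ⟨hx, hy⟩, rfl⟩ := he
  exact hG y hy x hx

/-- The second Bonferroni inequality. When q(a - 1) ≤ 1/10, a vertex outside a set of size a has a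
neighbor in it with probability at least 19/20 · aq. -/
theorem one_sub_pow_le {q : ℝ} (h0 : 0 ≤ q) (h1 : q ≤ 1) (a : ℕ) :
    (1 - q) ^ a ≤ 1 - a * q + a * (a - 1) / 2 * q ^ 2 := by
  induction a with
  | zero => simp
  | succ a ih =>
    rw [pow_succ]
    have := mul_le_mul_of_nonneg_right ih (by linarith : 0 ≤ 1 - q)
    have h3 : (0 : ℝ) ≤ a * (a - 1) / 2 * q ^ 2 * q := by
      rcases Nat.eq_zero_or_pos a with rfl | ha
      · simp
      · have : (1 : ℝ) ≤ a := by exact_mod_cast ha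
        have : (0 : ℝ) ≤ a - 1 := by linarith
        positivity
    push_cast
    nlinarith

/-- Chernoff's bound for the number of vertices outside `A` without a neighbor in `A`. The exponent
`#A` is what pays for the union bound over all `A`. -/
theorem binomialRandom_real_card_sdiff_lt_le (hD : D = Fintype.card V * p) (hD1 : 100 ≤ D)
    (A : Finset V) (hne : A.Nonempty) (hA : (p : ℝ) * (#A - 1) ≤ 1 / 10) :
    (binomialRandom V p).real {G | (#(G.neighborFinsetOf A \ A) : ℝ) < 4 / 5 * (#A * D)} ≤
      Real.exp (-(D / 400)) ^ #A := by
  have hp0 : 0 ≤ (p : ℝ) := p.2.1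
  have hp1 : (p : ℝ) ≤ 1 := p.2.2
  set a : ℝ := (#A : ℝ) with ha
  set n : ℝ := (Fintype.card V : ℝ) with hn
  set r : ℝ := (1 - p : ℝ) ^ #A with hr
  set s : ℝ := 1 - Real.exp (-(1 / 20)) with hs
  have ha1 : 1 ≤ a := by rw [ha]; exact_mod_cast Finset.card_pos.2 hne
  have hn1 : 100 ≤ n := by nlinarith
  have hp : 0 < (p : ℝ) := by
    by_contra! h
    nlinarith
  have hr0 : 0 ≤ r := pow_nonneg (by linarith) _
  have hr1 : 19 / 20 * (a * p) ≤ 1 - r := by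
    have h1 := one_sub_pow_le hp0 hp1 (#A)
    have h2 := mul_le_mul_of_nonneg_left hA (by positivity : 0 ≤ a * p / 2)
    linarith
  have han : 19 / 20 * n ≤ n - a := by
    have h1 : 100 * a ≤ 2 * n := by
      have h2 : 100 * (p * (a - 1)) ≤ D / 10 := by linarith
      rw [hD] at h2
      have h3 : p * (100 * (a - 1)) ≤ p * (n / 10) := by linarith
      have := le_of_mul_le_mul_left h3 hp
      nlinarith
    linarith
  have hs0 : 19 / 400 ≤ s := by
    have hexp := (abs_le.1 (Real.abs_exp_sub_one_sub_id_le (x := -(1 / 20))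
      (by rw [abs_neg, abs_of_pos] <;> norm_num))).2
    linarith
  have hcardc : (#(Aᶜ) : ℝ) = n - a := by
    rw [Finset.card_compl, Nat.cast_sub (Finset.card_le_univ _)]
  have h1 := measureReal_card_filter_ge_le (binomialRandom V p) Aᶜ
    (fun y ↦ {G : SimpleGraph V | ∀ x ∈ A, ¬ G.Adj x y}) r (1 / 20) (n - a - 4 / 5 * (a * D))
    (by norm_num) fun T hT ↦ binomialRandom_real_forall_not_adj_le A T
      (Finset.disjoint_right.2 fun y hy ↦ Finset.mem_compl.1 (hT hy))
  calc _ ≤ _ := by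
        refine measureReal_mono fun G hG ↦ ?_
        have hsplit : #(G.neighborFinsetOf A \ A) + #{y ∈ Aᶜ | ∀ x ∈ A, ¬ G.Adj x y} = #(Aᶜ) := by
          rw [← Finset.card_filter_add_card_filter_not (s := Aᶜ) fun y ↦ ∃ x ∈ A, G.Adj x y]
          congr 2
          · ext y
            simp [and_comm]
          · ext y
            simp
        have hsplit' : (#(G.neighborFinsetOf A \ A) : ℝ) + #{y ∈ Aᶜ | ∀ x ∈ A, ¬ G.Adj x y} =
            n - a := by rw [← hcardc]; exact_mod_cast hsplit
        simp only [Set.mem_ofPred_eq] at hG ⊢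
        linarith
    _ ≤ _ := h1
    _ = Real.exp (4 / 100 * (a * D)) * (1 - s * (1 - r)) ^ #(Aᶜ) := by
        have h2 : Real.exp (-(1 / 20 * (n - a - 4 / 5 * (a * D)))) =
            Real.exp (4 / 100 * (a * D)) * Real.exp (-(1 / 20)) ^ #(Aᶜ) := by
          rw [← Real.exp_nat_mul, ← Real.exp_add, hcardc]
          ring_nf
        rw [h2, mul_assoc, ← mul_pow]
        congr 2
        have h3 : Real.exp (-(1 / 20)) * Real.exp (1 / 20) = 1 := by
          rw [← Real.exp_add]; simp
        linear_combination r * h3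
    _ ≤ Real.exp (4 / 100 * (a * D)) * Real.exp (-(s * (1 - r))) ^ #(Aᶜ) := by
        have hs1 : s ≤ 1 := by linarith [Real.exp_pos (-(1 / 20))]
        have : 0 ≤ 1 - s * (1 - r) := by nlinarith
        gcongr
        linarith [Real.add_one_le_exp (-(s * (1 - r)))]
    _ ≤ _ := by
        rw [← Real.exp_nat_mul, ← Real.exp_nat_mul, ← Real.exp_add, hcardc, Real.exp_le_exp, ← ha]
        -- The product of constants, about 0.0429, just exceeds 4/100 + 1/400.
        have h2 : 19 / 20 * n * (19 / 400 * (19 / 20 * (a * p))) ≤ (n - a) * (s * (1 - r)) := by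
          gcongr
          linarith
        have h3 : 19 / 20 * n * (19 / 400 * (19 / 20 * (a * p))) =
            19 / 20 * (19 / 400) * (19 / 20) * (a * D) := by rw [hD]; ring
        have h4 : 0 ≤ a * D := by positivity
        linarith

/-- The failure probability, for explicit values of the parameters. -/
theorem le_binomialRandom_real_hasEccentricityTriangle (hp : 0 < (p : ℝ)) (hp1 : (p : ℝ) < 1)
    (hD : D = Fintype.card V * p) (hD1 : 100 ≤ D) (hm : 1 ≤ m₀) (hDm : 3 * m₀ ≤ 2 / 25 * D)
    (n : ℕ) (hn : n = Fintype.card V) :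
    1 - (n * Real.exp (-(D / 400)) + ((1 + Real.exp (-(D / 400))) ^ n - 1) +
        (n + 1) * n ^ 2 * Real.exp (-m₀) + (n + 1) * n * Real.exp (-(m₀ / 25)) +
        n * (p : ℝ) ^ (n - 1)) ≤
      (binomialRandom V p).real {G | ∀ u, G.HasEccentricityTriangle u} := by
  set μ := binomialRandom V p
  set F₁ : Set (SimpleGraph V) := ⋃ x ∈ (univ : Finset V), {G | 11 / 10 * D < #{y | G.Adj x y}}
  set F₂ : Set (SimpleGraph V) := ⋃ A ∈ ({A | A.Nonempty ∧ (p : ℝ) * (#A - 1) ≤ 1 / 10} :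
    Finset (Finset V)), {G | (#(G.neighborFinsetOf A \ A) : ℝ) < 4 / 5 * (#A * D)}
  set F₃ : Set (SimpleGraph V) := ⋃ z ∈ range (n + 1) ×ˢ (univ : Finset (V × V)),
    {G | m₀ ≤ p * #(G.spherePairs z.2.1 z.2.2 z.1) ∧
      ∀ e ∈ G.spherePairs z.2.1 z.2.2 z.1, e ∉ G.edgeSet}
  set F₄ : Set (SimpleGraph V) := ⋃ z ∈ range (n + 1) ×ˢ (univ : Finset V),
    {G | m₀ / 25 ≤ p * #(G.privatePairs z.2 z.1) ∧ ∀ e ∈ G.privatePairs z.2 z.1, e ∉ G.edgeSet}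
  set F₅ : Set (SimpleGraph V) := ⋃ x ∈ (univ : Finset V),
    {G | ∀ e ∈ (univ.erase x).image fun y ↦ s(x, y), e ∈ G.edgeSet}
  have hF₁ : μ.real F₁ ≤ n * Real.exp (-(D / 400)) := by
    refine (measureReal_biUnion_finset_le _ _).trans ((Finset.sum_le_sum fun x _ ↦
      binomialRandom_real_card_adj_gt_le x hD).trans_eq ?_)
    rw [Finset.sum_const, nsmul_eq_mul, Finset.card_univ, hn]
  have hF₂ : μ.real F₂ ≤ (1 + Real.exp (-(D / 400))) ^ n - 1 := by
    refine (measureReal_biUnion_finset_le _ _).trans ((Finset.sum_le_sum fun A hA ↦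
      binomialRandom_real_card_sdiff_lt_le hD hD1 A (Finset.mem_filter.1 hA).2.1
        (Finset.mem_filter.1 hA).2.2).trans ?_)
    -- The union bound over all sets is a binomial expansion; the empty set accounts for the
    -- subtracted 1.
    have h1 : ∑ A : Finset V, Real.exp (-(D / 400)) ^ #A = (1 + Real.exp (-(D / 400))) ^ n := by
      have := Finset.sum_pow_mul_eq_add_pow (Real.exp (-(D / 400))) 1 (univ : Finset V)
      simpa [add_comm, hn] using this
    rw [← h1, ← Finset.add_sum_erase _ _ (Finset.mem_univ ∅), Finset.card_empty, pow_zero,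
      add_sub_cancel_left]
    refine Finset.sum_le_sum_of_subset_of_nonneg (fun A hA ↦ ?_) fun _ _ _ ↦ by positivity
    exact Finset.mem_erase.2 ⟨(Finset.mem_filter.1 hA).2.1.ne_empty, Finset.mem_univ _⟩
  have hF₃ : μ.real F₃ ≤ (n + 1) * n ^ 2 * Real.exp (-m₀) := by
    have h := fun z : ℕ × V × V ↦
      binomialRandom_real_deferred_le_exp hp (fun G ↦ G.spherePairs z.2.1 z.2.2 z.1)
        (fun _ ↦ not_isDiag_of_mem_spherePairs) (fun _ _ ↦ spherePairs_congr) m₀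
    refine (measureReal_biUnion_finset_le _ _).trans
      ((Finset.sum_le_sum fun z _ ↦ h z).trans_eq ?_)
    rw [Finset.sum_const, nsmul_eq_mul, Finset.card_product, Finset.card_univ, Fintype.card_prod,
      Finset.card_range, ← hn]
    push_cast
    ring
  have hF₄ : μ.real F₄ ≤ (n + 1) * n * Real.exp (-(m₀ / 25)) := by
    have h := fun z : ℕ × V ↦
      binomialRandom_real_deferred_le_exp hp (fun G ↦ G.privatePairs z.2 z.1)
        (fun _ ↦ not_isDiag_of_mem_privatePairs) (fun _ _ ↦ privatePairs_congr) (m₀ / 25)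
    refine (measureReal_biUnion_finset_le _ _).trans
      ((Finset.sum_le_sum fun z _ ↦ h z).trans_eq ?_)
    rw [Finset.sum_const, nsmul_eq_mul, Finset.card_product, Finset.card_univ,
      Finset.card_range, ← hn]
    push_cast
    ring
  have hF₅ : μ.real F₅ ≤ n * (p : ℝ) ^ (n - 1) := by
    refine (measureReal_biUnion_finset_le _ _).trans ((Finset.sum_le_sum fun x _ ↦
      binomialRandom_real_forall_mem_edgeSet_le p _).trans_eq ?_)
    simp_rw [Finset.card_image_of_injective _ fun a b hab ↦ Sym2.congr_right.1 hab,
      Finset.card_erase_of_mem (Finset.mem_univ _)]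
    rw [Finset.sum_const, nsmul_eq_mul, Finset.card_univ, hn]
  have hgood : {G : SimpleGraph V | ∀ u, G.HasEccentricityTriangle u}ᶜ ⊆
      F₁ ∪ F₂ ∪ F₃ ∪ F₄ ∪ F₅ := by
    intro G
    contrapose
    simp only [Set.mem_union, not_or, Set.mem_compl_iff, not_not]
    rintro ⟨⟨⟨⟨h₁, h₂⟩, h₃⟩, h₄⟩, h₅⟩ u
    have hexp : G.ExpandsBy p D := by
      refine ⟨fun x ↦ not_lt.1 fun h ↦ h₁ ?_, fun A hA hA1 ↦ not_lt.1 fun h ↦ h₂ ?_⟩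
      · exact Set.mem_biUnion (Finset.mem_univ x) h
      · exact Set.mem_biUnion (Finset.mem_filter.2 ⟨Finset.mem_univ A, hA, hA1⟩) h
    refine hexp.hasEccentricityTriangle hp hp1 hD1 hm hDm (fun x ↦ ?_) (fun k hk v hv ↦ ?_)
      fun d hd hv ↦ ?_
    · by_contra! hcon
      refine h₅ (Set.mem_biUnion (Finset.mem_univ x) fun e he ↦ ?_)
      obtain ⟨y, hy, rfl⟩ := Finset.mem_image.1 he
      exact hcon y (Finset.ne_of_mem_erase hy).symm
    · by_contra! hcon
      exact h₃ (Set.mem_biUnion (x := (k, u, v)) (Finset.mem_product.2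
        ⟨Finset.mem_range.2 (by omega), Finset.mem_univ _⟩) ⟨hv, hcon⟩)
    · by_contra! hcon
      exact h₄ (Set.mem_biUnion (x := (d, u)) (Finset.mem_product.2
        ⟨Finset.mem_range.2 (by omega), Finset.mem_univ _⟩) ⟨hv, hcon⟩)
  have hcompl := measureReal_compl (μ := μ)
    (s := {G : SimpleGraph V | ∀ u, G.HasEccentricityTriangle u}) .of_discrete
  rw [probReal_univ] at hcompl
  have hle := measureReal_mono (μ := μ) hgood
  have h1 := measureReal_union_le (μ := μ) (F₁ ∪ F₂ ∪ F₃ ∪ F₄) F₅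
  have h2 := measureReal_union_le (μ := μ) (F₁ ∪ F₂ ∪ F₃) F₄
  have h3 := measureReal_union_le (μ := μ) (F₁ ∪ F₂) F₃
  have h4 := measureReal_union_le (μ := μ) F₁ F₂
  linarith

end

end SimpleGraph

/-! ### Asymptotics in n. -/

open Filter Topology

/-- The numerical conditions on `n` that the theorem needs, collected. -/
theorem eventually_rpow_bounds {ε δ : ℝ} (hε₀ : 0 < ε) (hε₁ : ε < 1) (hδ : 0 < δ) :
    ∀ᶠ n : ℕ in atTop, 1 ≤ (n : ℝ) ∧ 100 ≤ (n : ℝ) ^ ε ∧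
      100 * (n : ℝ) ^ (ε / 2) ≤ (n : ℝ) ^ ε ∧
      (n : ℝ) ^ (ε / 2) / 25 ≤ δ * (n - 1) ∧
      8 * (n : ℝ) ^ 3 * Real.exp (-((n : ℝ) ^ (ε / 2) / 25)) ≤ Real.exp (-((n : ℝ) ^ (ε / 4))) := by
  have hcast := tendsto_natCast_atTop_atTop (R := ℝ)
  have hpow : ∀ a : ℝ, 0 < a → Tendsto (fun n : ℕ ↦ (n : ℝ) ^ a) atTop atTop := fun a ha ↦
    (tendsto_rpow_atTop ha).comp hcast
  have hlog := (isLittleO_log_rpow_atTop (half_pos hε₀)).def (show (0 : ℝ) < 1 / 1000 by norm_num)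
  filter_upwards [eventually_ge_atTop 2, (hpow ε hε₀).eventually_ge_atTop 100,
    (hpow (ε / 2) (by linarith)).eventually_ge_atTop 1000,
    (hpow (ε / 4) (by linarith)).eventually_ge_atTop 100,
    (hpow (1 - ε / 2) (by linarith)).eventually_ge_atTop (1 / δ), hcast.eventually hlog]
    with n hn h1 h2 h3 h4 h5
  have hn2 : (2 : ℝ) ≤ n := by exact_mod_cast hn
  have hn0 : (0 : ℝ) < n := by linarith
  have hsq : (n : ℝ) ^ (ε / 2) * (n : ℝ) ^ (ε / 2) = (n : ℝ) ^ ε := by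
    rw [← Real.rpow_add hn0]; ring_nf
  have hsq' : (n : ℝ) ^ (ε / 4) * (n : ℝ) ^ (ε / 4) = (n : ℝ) ^ (ε / 2) := by
    rw [← Real.rpow_add hn0]; ring_nf
  have hone : (n : ℝ) ^ (1 - ε / 2) * (n : ℝ) ^ (ε / 2) = n := by
    rw [← Real.rpow_add hn0]; ring_nf; exact Real.rpow_one _
  refine ⟨by linarith, h1, by nlinarith, ?_, ?_⟩
  · have h6 : 1 ≤ δ * (n : ℝ) ^ (1 - ε / 2) := by
      rw [div_le_iff₀ hδ] at h4; linarith
    have h7 : (n : ℝ) ^ (ε / 2) ≤ δ * n := by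
      calc _ ≤ δ * (n : ℝ) ^ (1 - ε / 2) * (n : ℝ) ^ (ε / 2) := by nlinarith
        _ = _ := by rw [mul_assoc, hone]
    have : δ * 2 ≤ δ * n := by gcongr
    linarith
  · have hlogn : 0 ≤ Real.log n := Real.log_nonneg (by linarith)
    rw [Real.norm_of_nonneg hlogn, Real.norm_of_nonneg (by positivity)] at h5
    -- As n ≥ 2, the left side is at most n^6. The logarithm is negligible against n^(ε/2), which is
    -- the square of n^(ε/4).
    have h8 : 8 * (n : ℝ) ^ 3 ≤ Real.exp (6 * Real.log n) := by
      have : Real.exp (6 * Real.log n) = (n : ℝ) ^ 6 := by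
        rw [show (6 : ℝ) = (6 : ℕ) by norm_num, Real.exp_nat_mul, Real.exp_log hn0]
      rw [this]
      have : (2 : ℝ) ^ 3 ≤ (n : ℝ) ^ 3 := by gcongr
      nlinarith [pow_pos hn0 3]
    calc _ ≤ Real.exp (6 * Real.log n) * Real.exp (-((n : ℝ) ^ (ε / 2) / 25)) := by gcongr
      _ ≤ _ := by
        rw [← Real.exp_add, Real.exp_le_exp]
        nlinarith

theorem mainTheorem8 (ε : ℝ) (hε₀ : 0 < ε) (hε₁ : ε < 1) :
    ∃ c : ℝ, 0 < c ∧ ∀ δ : ℝ, 0 < δ → ∃ n₀ : ℕ, ∀ n : ℕ, n₀ ≤ n →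
      ∀ p : unitInterval, (n : ℝ) ^ (ε - 1) ≤ (p : ℝ) → (p : ℝ) ≤ 1 - δ →
        1 - Real.exp (-((n : ℝ) ^ c)) ≤
          (SimpleGraph.binomialRandom (Fin n) p).real
            {G : SimpleGraph (Fin n) | ∀ u : Fin n, G.HasEccentricityTriangle u} := by
  -- With `m₀` = n^(ε/2), the failure probability is at most 8n³ exp(-`m₀`/25); the smaller exponent
  -- ε/4 absorbs the polynomial factor and the 25.
  refine ⟨ε / 4, by linarith, fun δ hδ ↦ ?_⟩
  obtain ⟨n₀, hn₀⟩ := eventually_atTop.1 (eventually_rpow_bounds hε₀ hε₁ hδ)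
  refine ⟨n₀, fun n hn p hp hpδ ↦ ?_⟩
  obtain ⟨h1, h2, h3, h4, h5⟩ := hn₀ n hn
  have hn0 : (0 : ℝ) < n := by linarith
  have hp0 : 0 < (p : ℝ) := (Real.rpow_pos_of_pos hn0 _).trans_le hp
  have hD : (n : ℝ) ^ ε ≤ n * p := by
    calc (n : ℝ) ^ ε = n * (n : ℝ) ^ (ε - 1) := by
          rw [← Real.rpow_one_add' hn0.le] <;> ring_nf; exact hε₀.ne'
      _ ≤ _ := by gcongr
  set m := (n : ℝ) ^ (ε / 2)
  set y := Real.exp (-(m / 25))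
  have hm0 : 1 ≤ m := Real.one_le_rpow h1 (by linarith)
  refine le_trans ?_ (SimpleGraph.le_binomialRandom_real_hasEccentricityTriangle (V := Fin n)
    (D := n * p) (m₀ := m) hp0 (by linarith) (by simp) (by linarith) hm0 (by linarith) n (by simp))
  have hy0 : 0 < y := Real.exp_pos _
  have hyD : Real.exp (-(n * p / 400)) ≤ y := Real.exp_le_exp.2 (by linarith)
  have hym : Real.exp (-m) ≤ y := Real.exp_le_exp.2 (by linarith)
  have hyp : (p : ℝ) ^ (n - 1) ≤ y := by
    calc (p : ℝ) ^ (n - 1) ≤ Real.exp (-δ) ^ (n - 1) := by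
          gcongr
          linarith [Real.add_one_le_exp (-δ)]
      _ = Real.exp (-(δ * (n - 1))) := by
          rw [← Real.exp_nat_mul, Nat.cast_sub (by exact_mod_cast h1)]
          push_cast
          ring_nf
      _ ≤ y := Real.exp_le_exp.2 (by linarith)
  have hn2 : (n : ℝ) ≤ n ^ 2 := by nlinarith
  have hn3 : (n : ℝ) ^ 2 ≤ n ^ 3 := by nlinarith
  have hny : n * y ≤ 1 := by
    have h6 : 8 * (n : ℝ) ^ 3 * y ≤ 1 := h5.trans (Real.exp_le_one_iff.2 (by
      have : 0 ≤ (n : ℝ) ^ (ε / 4) := by positivity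
      linarith))
    have h7 : (n : ℝ) * y ≤ n ^ 3 * y := by gcongr; linarith
    nlinarith
  have hpow : (1 + Real.exp (-(n * p / 400))) ^ n - 1 ≤ 2 * (n * y) := by
    calc (1 + Real.exp (-(n * p / 400))) ^ n - 1 ≤ Real.exp y ^ n - 1 := by
          gcongr
          linarith [Real.add_one_le_exp y]
      _ = Real.exp (n * y) - 1 := by rw [← Real.exp_nat_mul]
      _ ≤ n * y + (n * y) ^ 2 := by
          have := (abs_le.1 (Real.abs_exp_sub_one_sub_id_le (x := n * y)
            (by rwa [abs_of_nonneg (by positivity)]))).2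
          linarith
      _ ≤ _ := by nlinarith [mul_pos hn0 hy0]
  have e1 : n * Real.exp (-(n * p / 400)) ≤ n * y := by gcongr
  have e3 : ((n : ℝ) + 1) * n ^ 2 * Real.exp (-m) ≤ (n + 1) * n ^ 2 * y := by gcongr
  have e5 : (n : ℝ) * (p : ℝ) ^ (n - 1) ≤ n * y := by gcongr
  have e6 : (n : ℝ) * y + 2 * (n * y) + (n + 1) * n ^ 2 * y + (n + 1) * n * y + n * y ≤
      8 * n ^ 3 * y := by
    have : (n : ℝ) + 2 * n + (n + 1) * n ^ 2 + (n + 1) * n + n ≤ 8 * n ^ 3 := by nlinarith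
    nlinarith
  linarith
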